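/- Let $S$ be a closed surface with a finite cellular decomposition $\Sigma=(V,E,F)$, in which every 2-cell has at least one 1-cell in its boundary, and let $\Phi\colon E\to(0,\tfrac{\pi}{2})$ be a weight. Given radii $\mathbf r\in(0,\tfrac{\pi}{2})^{F}$, take for each $e\in E$ two disks in the unit sphere $\mathbb S^2$ whose radii are those of the two 2-cells on the sides of $e$ (which may coincide), placed so that their intersection is a bigon $B_e$ with interior angle $\Phi(e)$; such a pair of disks is unique up to isometry. Let $Q(e)$ be the spherical quadrilateral spanned by the two centers and the two vertices of $B_e$. Gluing the quadrilaterals $Q(e)$ along their sides, according to the triangulation of $S$ obtained by joining an auxiliary point of each 2-cell to the vertices on its boundary, gives a spherical conical metric $\mu$ on $S$ together with a circle pattern $\mathcal P$, whose disks are centered at the auxiliary points and have radii $\mathbf r$. A circle pattern metric on $S$ (realizing $(\Sigma,\Phi)$) is a pair $(\mu,\mathcal P)$ arising in this way, for some $\mathbf r\in(0,\tfrac{\pi}{2})^F$, from a cellular decomposition isotopic to $\Sigma$. Two circle pattern metrics are the same up to isometry if there is an isometry between them that is isotopic to the identity of $S$ and carries the disks of one pattern to the corresponding disks of the other. For $f\in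 F$, the total geodesic curvature $L_f$ is the sum of $\ell\cdot\cot r_f$ over all sides of 1-cells that face $f$ (a 1-cell with $f$ on both sides counts twice), where $\ell$ is the length of the corresponding side of the bigon $B_e$, that is, of the arc of the boundary circle of the disk of $f$ that lies in the other disk. For $F'\subset F$ let $E_{F'}$ be the set of 1-cells in the boundary of some 2-cell of $F'$, and let $$\mathcal L_1=\Big\{(L_f)_{f\in F}\in\mathbb R_{>0}^{F}\ \Big|\ \sum_{f\in F'}L_f<2\sum_{e\in E_{F'}}\Phi(e)\ \text{ for every nonempty } F'\subset F\Big\}.$$ Then, for every $\hat L\in\mathbb R^{F}$, there exists a circle pattern metric on $S$ with total geodesic curvature $\hat L$ if and only if $\hat L\in\mathcal L_1$. Moreover, the circle pattern metric with total geodesic curvature $\hat L$ is unique up to isometry if it exists. -/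

import Mathlib

open Real Set

noncomputable section

namespace CirclePattern

/-! ### Two disks on the unit sphere -/

/-- The point of the unit sphere at spherical distance `r` from the north pole `(0, 0, 1)`, in the
direction of azimuth `τ`. For fixed `r`, it runs once through the circle of spherical radius `r`
about the north pole as `τ` runs through `(-π, π]`, with constant speed `sin r`. -/
def circlePoint (r τ : ℝ) : EuclideanSpace ℝ (Fin 3) :=
  !₂[sin r * cos τ, sin r * sin τ, cos r]

/-- The north pole. -/
def northPole : EuclideanSpace ℝ (Fin 3) := !₂[0, 0, 1]

/-- The open disk of spherical radius `r` about the point `c` of the unit sphere; the spherical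
distance of two points of the unit sphere is the angle between them. -/
def sphericalDisk (c : EuclideanSpace ℝ (Fin 3)) (r : ℝ) : Set (EuclideanSpace ℝ (Fin 3)) :=
  {x | ‖x‖ = 1 ∧ InnerProductGeometry.angle c x < r}

/-- The distance between the centers of two disks of radii `r₁`, `r₂` whose intersection is a bigon
of interior angle `φ`: at a vertex of the bigon, the radii towards the two centers make the angle
`π - φ`, and the distance is given by the spherical law of cosines. -/
def centerDist (r₁ r₂ φ : ℝ) : ℝ :=
  arccos (cos r₁ * cos r₂ + sin r₁ * sin r₂ * cos (π - φ))

/-- The disk `D₂` of radius `r₂` that meets the disk `D₁` of radius `r₁` about the north pole with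
intersection angle `φ`; its center is put at azimuth `0`. -/
def secondDisk (r₁ r₂ φ : ℝ) : Set (EuclideanSpace ℝ (Fin 3)) :=
  sphericalDisk (circlePoint (centerDist r₁ r₂ φ) 0) r₂

/-- The angle, seen from the center of `D₁`, of the side `∂D₁ ∩ D₂` of the bigon `D₁ ∩ D₂`. -/
def centralAngle (r₁ r₂ φ : ℝ) : ℝ :=
  (MeasureTheory.volume {τ : ℝ | τ ∈ Ioc (-π) π ∧ circlePoint r₁ τ ∈ secondDisk r₁ r₂ φ}).toReal

/-- The length of the side `∂D₁ ∩ D₂` of the bigon `D₁ ∩ D₂`. -/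
def bigonSideLength (r₁ r₂ φ : ℝ) : ℝ := centralAngle r₁ r₂ φ * sin r₁

/-- The three vertices of the spherical triangle spanned by the center of `D₁` (vertex `0`) and by
the two vertices of the bigon `D₁ ∩ D₂` (vertices `1` and `2`, the end points of the side
`∂D₁ ∩ D₂`). Together with the corresponding triangle at the center of `D₂` it forms the spherical
quadrilateral of the two disks. -/
def triangleVertex (r₁ r₂ φ : ℝ) : Fin 3 → EuclideanSpace ℝ (Fin 3) :=
  ![northPole, circlePoint r₁ (-(centralAngle r₁ r₂ φ / 2)),
    circlePoint r₁ (centralAngle r₁ r₂ φ / 2)]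

/-! ### Cellular decompositions -/

/-- The combinatorial part of a cellular decomposition of a closed surface: polygons, whose sides
are glued in pairs. `E` is the set of 1-cells and `F` the set of 2-cells. Every 1-cell `e` has two
sides `(e, false)` and `(e, true)`; `face s` is the 2-cell on that side (the two may coincide), and
`next` is the cyclic order of the sides in the boundary of each 2-cell. The cyclic orders orient the
2-cells; `twisted e` says that the two sides of `e` run through `e` in the same direction (so the
surface need not be orientable). The 0-cells are the classes of corners of the polygons. -/
structure CellData (E F : Type*) where
  face : E × Bool → F
  face_surjective : Function.Surjective face
  next : Equiv.Perm (E × Bool)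
  face_eq_iff : ∀ s s', face s = face s' ↔ next.SameCycle s s'
  twisted : E → Prop

namespace CellData

variable {E F : Type*} (C : CellData E F)

/-- The other side of the same 1-cell. -/
def opposite (s : E × Bool) : E × Bool := (s.1, !s.2)

/-- The gluing of triangles. A 2-cell with an auxiliary point inside it is cut into one triangle for
each of its sides `s`: vertex `0` is the auxiliary point, and vertices `1`, `2` are the initial and
the terminal point of the side. Points of the triangle are given by barycentric coordinates. -/
inductive Glue : (Σ _ : E × Bool, stdSimplex ℝ (Fin 3)) → (Σ _ : E × Bool, stdSimplex ℝ (Fin 3)) →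
    Prop
  /-- consecutive triangles of a 2-cell share the segment from the auxiliary point to a corner -/
  | spoke (s : E × Bool) (x y : stdSimplex ℝ (Fin 3)) (hx : x.1 1 = 0) (hy : y.1 2 = 0)
      (h₀ : x.1 0 = y.1 0) (h : x.1 2 = y.1 1) : Glue ⟨s, x⟩ ⟨C.next s, y⟩
  | edge (e : E) (he : ¬ C.twisted e) (x y : stdSimplex ℝ (Fin 3)) (hx : x.1 0 = 0) (hy : y.1 0 = 0)
      (h₁ : x.1 1 = y.1 2) (h₂ : x.1 2 = y.1 1) : Glue ⟨(e, false), x⟩ ⟨(e, true), y⟩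
  | twistedEdge (e : E) (he : C.twisted e) (x y : stdSimplex ℝ (Fin 3)) (hx : x.1 0 = 0)
      (hy : y.1 0 = 0) (h₁ : x.1 1 = y.1 1) (h₂ : x.1 2 = y.1 2) :
      Glue ⟨(e, false), x⟩ ⟨(e, true), y⟩

/-- The closed surface obtained by the gluing, with the quotient topology. -/
def Realization : Type _ := Quot C.Glue

instance : TopologicalSpace C.Realization :=
  inferInstanceAs (TopologicalSpace (Quot C.Glue))

/-- The point with barycentric coordinates `x` of the triangle at the side `s`. -/
def point (s : E × Bool) (x : stdSimplex ℝ (Fin 3)) : C.Realization := Quot.mk C.Glue ⟨s, x⟩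

/-- The auxiliary point of the 2-cell on the side `s`. -/
def center (s : E × Bool) : C.Realization := C.point s ⟨Pi.single 0 1, single_mem_stdSimplex ℝ 0⟩

/-- For radii `r` and weight `Φ`, the triangle at the side `s` becomes a spherical triangle: the half
that belongs to the 2-cell `face s` of the spherical quadrilateral of two disks with the radii of
the two adjacent 2-cells and with intersection angle `Φ`. The point with barycentric coordinates `x`
is the radial projection to the unit sphere of the vector given here. -/
def trianglePoint (Φ : E → ℝ) (r : F → ℝ) (s : E × Bool) (x : stdSimplex ℝ (Fin 3)) :
    EuclideanSpace ℝ (Fin 3) :=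
  ∑ i, x.1 i • triangleVertex (r (C.face s)) (r (C.face (opposite s))) (Φ s.1) i

/-- `BrokenGeodesic Φ r p q ℓ`: there is a path of length `ℓ` from `p` to `q` which consists of
finitely many geodesic segments, each of them inside one of the spherical triangles. (The spherical
distance of the radial projections of two vectors is the angle between the vectors.) -/
inductive BrokenGeodesic (Φ : E → ℝ) (r : F → ℝ) : C.Realization → C.Realization → ℝ → Prop
  | refl (p : C.Realization) : BrokenGeodesic Φ r p p 0
  | cons (s : E × Bool) (x y : stdSimplex ℝ (Fin 3)) (q : C.Realization) (ℓ : ℝ)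
      (h : BrokenGeodesic Φ r (C.point s y) q ℓ) :
      BrokenGeodesic Φ r (C.point s x) q
        (InnerProductGeometry.angle (C.trianglePoint Φ r s x) (C.trianglePoint Φ r s y) + ℓ)

/-- The distance of the spherical conical metric obtained by gluing the spherical triangles, i.e. the
infimum of the lengths of the broken geodesics (`∞` between different components). -/
def gluedDist (Φ : E → ℝ) (r : F → ℝ) (p q : C.Realization) : ENNReal :=
  ⨅ (ℓ : ℝ) (_ : C.BrokenGeodesic Φ r p q ℓ), ENNReal.ofReal ℓ

/-- The total geodesic curvature of the 2-cell `f`: the sum, over the sides in its boundary, of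
length times geodesic curvature `cot r_f` of the corresponding side of the bigon. -/
def totalGeodesicCurvature [Fintype E] (Φ : E → ℝ) (r : F → ℝ) (f : F) : ℝ :=
  open Classical in
  ∑ s : E × Bool with C.face s = f,
    bigonSideLength (r (C.face s)) (r (C.face (opposite s))) (Φ s.1) * cot (r (C.face s))

/-- `E_{F'}`, the set of 1-cells in the boundary of some 2-cell in `F'`. -/
def edgesOf [Fintype E] (F' : Finset F) : Finset E :=
  open Classical in
  Finset.univ.filter fun e => ∃ b : Bool, C.face (e, b) ∈ F'

/-- The set `𝓛₁` of positive vectors with `∑_{f ∈ F'} L_f < 2 ∑_{e ∈ E_{F'}} Φ(e)` for every nonempty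
set `F'` of 2-cells. -/
def admissible [Fintype E] (Φ : E → ℝ) : Set (F → ℝ) :=
  {L | (∀ f, 0 < L f) ∧
    ∀ F' : Finset F, F'.Nonempty → ∑ f ∈ F', L f < 2 * ∑ e ∈ C.edgesOf F', Φ e}

end CellData

/-- A cellular decomposition of the space `S`, with 1-cells `E` and 2-cells `F`: `S` is identified
with the surface that arises from polygons by gluing their sides in pairs. (If `E` is finite, such an
`S` is a closed surface.) -/
structure CellularDecomposition (S E F : Type*) [TopologicalSpace S] extends CellData E F where
  homeo : toCellData.Realization ≃ₜ S

/-- Two homeomorphisms are isotopic if they are joined by a continuous family of homeomorphisms. -/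
def Isotopic {X Y : Type*} [TopologicalSpace X] [TopologicalSpace Y] (g h : X ≃ₜ Y) : Prop :=
  ∃ H : unitInterval → (X ≃ₜ Y),
    Continuous (fun p : unitInterval × X => H p.1 p.2) ∧ H 0 = g ∧ H 1 = h

/-- A circle pattern metric on `S` which realizes the weighted cellular decomposition `(Σ, Φ)`: a
distance function on `S` that is, through a cellular decomposition `marking` isotopic to the given
one, the spherical conical metric glued from the spherical quadrilaterals for radii in `(0, π/2)`.
The disks of the circle pattern are those with the radii `radius f`, centered at the auxiliary points
of the 2-cells. -/
structure CirclePatternMetric {S E F : Type*} [TopologicalSpace S]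
    (C : CellularDecomposition S E F) (Φ : E → ℝ) where
  dist : S → S → ENNReal
  radius : F → ℝ
  radius_mem : ∀ f, radius f ∈ Ioo 0 (π / 2)
  marking : C.toCellData.Realization ≃ₜ S
  isotopic : Isotopic marking C.homeo
  dist_eq : ∀ p q, dist (marking p) (marking q) = C.toCellData.gluedDist Φ radius p q

namespace CirclePatternMetric

variable {S E F : Type*} [TopologicalSpace S] {C : CellularDecomposition S E F} {Φ : E → ℝ}

/-- The vector of total geodesic curvatures of a circle pattern metric. -/
def totalGeodesicCurvature [Fintype E] (μ : CirclePatternMetric C Φ) : F → ℝ :=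
  C.toCellData.totalGeodesicCurvature Φ μ.radius

/-- `μ₁` and `μ₂` agree up to isometry: there is an isometry of `S` from `μ₁` to `μ₂`, isotopic to the
identity, which carries the disks of the circle pattern of `μ₁` (given by center and radius) to those
of `μ₂`. -/
def IsIsometric (μ₁ μ₂ : CirclePatternMetric C Φ) : Prop :=
  ∃ g : S ≃ₜ S, Isotopic g (Homeomorph.refl S) ∧
    (∀ x y, μ₂.dist (g x) (g y) = μ₁.dist x y) ∧
    (∀ s : E × Bool, g (μ₁.marking (C.toCellData.center s)) =
      μ₂.marking (C.toCellData.center s)) ∧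
    ∀ f, μ₁.radius f = μ₂.radius f

end CirclePatternMetric

end CirclePattern

end

open Filter Topology

namespace CirclePattern

/-! ### The curvature of a side of a bigon in terms of the geodesic curvatures of the circles -/

/-! Take the geodesic curvatures `k = cot r` as variables, so that a shrinking disk has growing `k`.
The sphere enters only through `bigonSideLength_mul_cot`, which turns the curvature of a bigon side
into `arcCurvature φ k₁ k₂`. Two monotonicities carry the proof. The curvature of one side decreases
in the curvature of the other circle (`arcCurvature_anti`), whereas the sum over both sides of a
bigon strictly increases in each variable (`arcCurvature_add_strictMono`). The geometric reason for
the latter is Gauss–Bonnet: the sum is `2φ` minus the area of the bigon. The proof here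
differentiates explicitly instead. The sum stays below `2φ`, and summing over 1-cells yields the
necessity of the inequalities.

Uniqueness is a maximum principle. If `k` and `k'` have the same face curvatures, these do not
increase on passing to `max k k'`, by the first monotonicity; but their total would strictly
increase, by the second, unless `k ≤ k'`.

Existence is Perron's method. Call `k` a subsolution if its face curvatures are at most `L`.
Admissibility of `L` bounds subsolutions from above: if the circles of `F'` shrank to points and the
others did not, the curvatures over `F'` would sum to nearly `2 ∑ Φ(e)` over the 1-cells of `F'`,
which exceeds `∑ L`. A subsolution maximizing `∑ k` is a solution, since at a face with too little
curvature `k` could be raised a little, and this only lowers the curvature of the other faces.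

Finally, the radii determine the metric up to isometry, the isometry being one marking composed with
the inverse of the other. -/

/-- Half of the central angle of a side of the bigon of interior angle `φ`, for circles of geodesic
curvatures `k₁` and `k₂`. -/
noncomputable def halfAngle (φ k₁ k₂ : ℝ) : ℝ := arctan (√(1 + k₁ ^ 2) * sin φ / (k₂ + k₁ * cos φ))

/-- The total geodesic curvature of a side of the bigon of interior angle `φ` which lies on the
circle of geodesic curvature `k₁`, where `k₂` is the geodesic curvature of the other circle. -/
noncomputable def arcCurvature (φ k₁ k₂ : ℝ) : ℝ := 2 * halfAngle φ k₁ k₂ * (k₁ / √(1 + k₁ ^ 2))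

section
variable {φ k₁ k₂ : ℝ}

lemma sin_cos_pos_of_mem (hφ : φ ∈ Ioo 0 (π / 2)) : 0 < sin φ ∧ 0 < cos φ :=
  ⟨sin_pos_of_pos_of_lt_pi hφ.1 (by linarith [hφ.2, pi_pos]),
    cos_pos_of_mem_Ioo ⟨by linarith [hφ.1, pi_pos], hφ.2⟩⟩

lemma sqrt_one_add_sq_pos (k : ℝ) : 0 < √(1 + k ^ 2) := sqrt_pos.2 (by positivity)

lemma halfAngle_pos (hφ : φ ∈ Ioo 0 (π / 2)) (h₁ : 0 < k₁) (h₂ : 0 < k₂) :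
    0 < halfAngle φ k₁ k₂ := by
  obtain ⟨hs, hc⟩ := sin_cos_pos_of_mem hφ
  have := sqrt_one_add_sq_pos k₁
  exact arctan_pos.2 (by positivity)

lemma arcCurvature_pos (hφ : φ ∈ Ioo 0 (π / 2)) (h₁ : 0 < k₁) (h₂ : 0 < k₂) :
    0 < arcCurvature φ k₁ k₂ := by
  have := sqrt_one_add_sq_pos k₁
  have := halfAngle_pos hφ h₁ h₂
  unfold arcCurvature
  positivity

lemma arcCurvature_anti (hφ : φ ∈ Ioo 0 (π / 2)) (h₁ : 0 < k₁) (h₂ : 0 < k₂) {k₂' : ℝ}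
    (h : k₂ ≤ k₂') : arcCurvature φ k₁ k₂' ≤ arcCurvature φ k₁ k₂ := by
  obtain ⟨hs, hc⟩ := sin_cos_pos_of_mem hφ
  have := sqrt_one_add_sq_pos k₁
  unfold arcCurvature halfAngle
  gcongr

/-- The central angle is at most `π`. This crude bound makes small constant curvatures a
subsolution. -/
lemma arcCurvature_le (h₁ : 0 < k₁) : arcCurvature φ k₁ k₂ ≤ π * k₁ := by
  have hw := sqrt_one_add_sq_pos k₁
  have h1 : 1 ≤ √(1 + k₁ ^ 2) := one_le_sqrt.2 (by nlinarith)
  have h2 : k₁ / √(1 + k₁ ^ 2) ≤ k₁ := div_le_self h₁.le h1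
  have h3 : 2 * halfAngle φ k₁ k₂ ≤ π := by
    have := (arctan_lt_pi_div_two (√(1 + k₁ ^ 2) * sin φ / (k₂ + k₁ * cos φ))).le
    unfold halfAngle; linarith
  exact mul_le_mul h3 h2 (by positivity) pi_pos.le

lemma continuousOn_arcCurvature (hφ : φ ∈ Ioo 0 (π / 2)) :
    ContinuousOn (fun p : ℝ × ℝ => arcCurvature φ p.1 p.2) (Ioi 0 ×ˢ Ioi 0) := by
  obtain ⟨hs, hc⟩ := sin_cos_pos_of_mem hφ
  unfold arcCurvature halfAngle
  refine ContinuousOn.mul (continuousOn_const.mul (continuous_arctan.comp_continuousOn ?_)) ?_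
  · refine ContinuousOn.div (by fun_prop) (by fun_prop) ?_
    rintro ⟨a, b⟩ ⟨ha, hb⟩
    simp only [mem_Ioi] at ha hb
    dsimp only
    positivity
  · exact ContinuousOn.div (by fun_prop) (by fun_prop) fun p _ => (sqrt_one_add_sq_pos p.1).ne'

/-! ### Monotonicity of the total curvature of a bigon -/

lemma hasDerivAt_sqrt_one_add_sq (k : ℝ) :
    HasDerivAt (fun x : ℝ => √(1 + x ^ 2)) (k / √(1 + k ^ 2)) k := by
  have h : HasDerivAt (fun x : ℝ => 1 + x ^ 2) (2 * k) k := by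
    simpa using (hasDerivAt_pow 2 k).const_add 1
  convert h.sqrt (by positivity) using 1
  field_simp

/-- The common denominator in the formulas for both half angles; it is symmetric in the two
curvatures. -/
lemma sq_add_sq_mul_sin_sq (φ k₁ k₂ : ℝ) :
    (k₂ + k₁ * cos φ) ^ 2 + (√(1 + k₁ ^ 2) * sin φ) ^ 2 =
      k₁ ^ 2 + k₂ ^ 2 + 2 * k₁ * k₂ * cos φ + sin φ ^ 2 := by
  rw [mul_pow, sq_sqrt (by positivity)]
  linear_combination k₁ ^ 2 * sin_sq_add_cos_sq φ

lemma arctan_div_deriv_factor {a b a' b' : ℝ} (hb : 0 < b) :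
    1 / (1 + (a / b) ^ 2) * ((a' * b - a * b') / b ^ 2) = (a' * b - a * b') / (b ^ 2 + a ^ 2) := by
  have : b ^ 2 + a ^ 2 ≠ 0 := by positivity
  field_simp

lemma hasDerivAt_halfAngle_left (hφ : φ ∈ Ioo 0 (π / 2)) (h₁ : 0 < k₁) (h₂ : 0 < k₂) :
    HasDerivAt (fun k => halfAngle φ k k₂)
      (sin φ * (k₁ * k₂ - cos φ) / (√(1 + k₁ ^ 2) *
        (k₁ ^ 2 + k₂ ^ 2 + 2 * k₁ * k₂ * cos φ + sin φ ^ 2))) k₁ := by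
  obtain ⟨hs, hc⟩ := sin_cos_pos_of_mem hφ
  have hw := sqrt_one_add_sq_pos k₁
  have hb : 0 < k₂ + k₁ * cos φ := by positivity
  have h := (((hasDerivAt_sqrt_one_add_sq k₁).mul_const (sin φ)).div
    (((hasDerivAt_id k₁).mul_const (cos φ)).const_add k₂) hb.ne').arctan
  refine HasDerivAt.congr_deriv h (Eq.symm ?_)
  simp only [id, Pi.div_apply]
  rw [arctan_div_deriv_factor hb, sq_add_sq_mul_sin_sq]
  have hD : 0 < k₁ ^ 2 + k₂ ^ 2 + 2 * k₁ * k₂ * cos φ + sin φ ^ 2 := by positivity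
  rw [div_eq_div_iff (by positivity) hD.ne']
  have hw2 := sq_sqrt (show 0 ≤ 1 + k₁ ^ 2 by positivity)
  generalize √(1 + k₁ ^ 2) = w at *
  field_simp
  linear_combination (cos φ) * hw2

lemma hasDerivAt_halfAngle_right (hφ : φ ∈ Ioo 0 (π / 2)) (h₁ : 0 < k₁) (h₂ : 0 < k₂) :
    HasDerivAt (fun k => halfAngle φ k₂ k)
      (-(√(1 + k₂ ^ 2) * sin φ) /
        (k₁ ^ 2 + k₂ ^ 2 + 2 * k₁ * k₂ * cos φ + sin φ ^ 2)) k₁ := by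
  obtain ⟨hs, hc⟩ := sin_cos_pos_of_mem hφ
  have hb : 0 < k₁ + k₂ * cos φ := by positivity
  have h := ((hasDerivAt_const k₁ (√(1 + k₂ ^ 2) * sin φ)).div
    ((hasDerivAt_id k₁).add_const (k₂ * cos φ)) hb.ne').arctan
  refine HasDerivAt.congr_deriv h (Eq.symm ?_)
  simp only [id, Pi.div_apply]
  rw [arctan_div_deriv_factor hb, sq_add_sq_mul_sin_sq]
  ring

lemma sin_mul_cos_arctan_div {a b : ℝ} (hb : 0 < b) :
    sin (arctan (a / b)) * cos (arctan (a / b)) = a * b / (b ^ 2 + a ^ 2) := by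
  rw [sin_arctan, cos_arctan, div_mul_div_comm, mul_self_sqrt (by positivity)]
  field_simp

lemma sin_mul_cos_lt_self {x : ℝ} (hx : 0 < x) : sin x * cos x < x := by
  have := sin_lt (show 0 < 2 * x by linarith)
  rw [sin_two_mul] at this
  linarith

/-- The derivatives of the two half angles share a denominator and combine to the term `-sin θ cos
θ`; the term `θ` comes from differentiating `k / √(1 + k²)`. Positivity is then `sin 2θ < 2θ`. -/
lemma hasDerivAt_arcCurvature_add (hφ : φ ∈ Ioo 0 (π / 2)) (h₁ : 0 < k₁) (h₂ : 0 < k₂) :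
    HasDerivAt (fun k => arcCurvature φ k k₂ + arcCurvature φ k₂ k)
      (2 / √(1 + k₁ ^ 2) ^ 3 *
        (halfAngle φ k₁ k₂ - sin (halfAngle φ k₁ k₂) * cos (halfAngle φ k₁ k₂))) k₁ := by
  obtain ⟨hs, hc⟩ := sin_cos_pos_of_mem hφ
  have hw := sqrt_one_add_sq_pos k₁
  have hv := sqrt_one_add_sq_pos k₂
  have hb : 0 < k₂ + k₁ * cos φ := by positivity
  have h := (((hasDerivAt_halfAngle_left hφ h₁ h₂).const_mul 2).mul
    ((hasDerivAt_id k₁).div (hasDerivAt_sqrt_one_add_sq k₁) hw.ne')).add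
    (((hasDerivAt_halfAngle_right hφ h₁ h₂).const_mul 2).mul_const (k₂ / √(1 + k₂ ^ 2)))
  refine HasDerivAt.congr_deriv h (Eq.symm ?_)
  have hsc : sin (halfAngle φ k₁ k₂) * cos (halfAngle φ k₁ k₂) = _ := sin_mul_cos_arctan_div hb
  rw [hsc, sq_add_sq_mul_sin_sq]
  simp only [id, Pi.div_apply]
  have hD : 0 < k₁ ^ 2 + k₂ ^ 2 + 2 * k₁ * k₂ * cos φ + sin φ ^ 2 := by positivity
  have hw2 := sq_sqrt (show 0 ≤ 1 + k₁ ^ 2 by positivity)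
  generalize k₁ ^ 2 + k₂ ^ 2 + 2 * k₁ * k₂ * cos φ + sin φ ^ 2 = D at *
  generalize √(1 + k₁ ^ 2) = w at *
  generalize √(1 + k₂ ^ 2) = v at *
  generalize halfAngle φ k₁ k₂ = θ at *
  field_simp
  linear_combination (w * sin φ * k₂ - θ * D) * hw2

lemma arcCurvature_add_strictMonoOn (hφ : φ ∈ Ioo 0 (π / 2)) (h₂ : 0 < k₂) :
    StrictMonoOn (fun k => arcCurvature φ k k₂ + arcCurvature φ k₂ k) (Ioi 0) := by
  refine strictMonoOn_of_deriv_pos (convex_Ioi 0)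
    (fun k hk => (hasDerivAt_arcCurvature_add hφ hk h₂).continuousAt.continuousWithinAt) ?_
  intro k hk
  rw [interior_Ioi] at hk
  rw [(hasDerivAt_arcCurvature_add hφ hk h₂).deriv]
  have := sqrt_one_add_sq_pos k
  have := sin_mul_cos_lt_self (halfAngle_pos hφ hk h₂)
  exact mul_pos (by positivity) (by linarith)

lemma arcCurvature_add_mono (hφ : φ ∈ Ioo 0 (π / 2)) (h₁ : 0 < k₁) (h₂ : 0 < k₂) {k₁' k₂' : ℝ}
    (h₁' : k₁ ≤ k₁') (h₂' : k₂ ≤ k₂') :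
    arcCurvature φ k₁ k₂ + arcCurvature φ k₂ k₁ ≤
      arcCurvature φ k₁' k₂' + arcCurvature φ k₂' k₁' := by
  have e1 := (arcCurvature_add_strictMonoOn hφ h₂).monotoneOn h₁ (h₁.trans_le h₁') h₁'
  have e2 := (arcCurvature_add_strictMonoOn hφ (h₁.trans_le h₁')).monotoneOn h₂
    (h₂.trans_le h₂') h₂'
  exact e1.trans (by linarith)

lemma arcCurvature_add_strictMono (hφ : φ ∈ Ioo 0 (π / 2)) (h₁ : 0 < k₁) (h₂ : 0 < k₂)
    {k₁' k₂' : ℝ} (h₁' : k₁ < k₁') (h₂' : k₂ ≤ k₂') :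
    arcCurvature φ k₁ k₂ + arcCurvature φ k₂ k₁ <
      arcCurvature φ k₁' k₂' + arcCurvature φ k₂' k₁' :=
  (arcCurvature_add_strictMonoOn hφ h₂ h₁ (h₁.trans h₁') h₁').trans_le
    (arcCurvature_add_mono hφ (h₁.trans h₁') h₂ le_rfl h₂')

/-! ### Limits for shrinking circles -/

lemma tendsto_div_sqrt_one_add_sq :
    Tendsto (fun k : ℝ => k / √(1 + k ^ 2)) atTop (𝓝 1) := by
  have h0 : Tendsto (fun k : ℝ => k⁻¹) atTop (𝓝 0) := tendsto_inv_atTop_zero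
  have h : Tendsto (fun k : ℝ => (√(k⁻¹ ^ 2 + 1))⁻¹) atTop (𝓝 1) := by
    have := (((h0.pow 2).add_const 1).sqrt).inv₀ (by simp)
    simpa using this
  refine h.congr' ?_
  filter_upwards [eventually_gt_atTop 0] with k hk
  have : 1 + k ^ 2 = k ^ 2 * (k⁻¹ ^ 2 + 1) := by field_simp
  rw [this, sqrt_mul (by positivity), sqrt_sq hk.le]
  have : √(k⁻¹ ^ 2 + 1) ≠ 0 := (sqrt_pos.2 (by positivity)).ne'
  field_simp

/-- Used with slope `a = cos φ` when only one circle shrinks, and `a = 1 + cos φ` when both shrink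
together. -/
lemma tendsto_sqrt_one_add_sq_div {a : ℝ} {g : ℝ → ℝ} (ha : a ≠ 0)
    (hg : Tendsto (fun k => g k / k) atTop (𝓝 a)) :
    Tendsto (fun k : ℝ => √(1 + k ^ 2) * sin φ / g k) atTop (𝓝 (sin φ / a)) := by
  have h := ((tendsto_div_sqrt_one_add_sq.mul hg).inv₀ (by simpa using ha)).const_mul (sin φ)
  rw [one_mul] at h
  refine h.congr' ?_
  filter_upwards [eventually_gt_atTop 0] with k hk
  have := sqrt_one_add_sq_pos k
  field_simp

/-- The curvature of a shrinking circle along a fixed one tends to twice the angle. -/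
lemma tendsto_arcCurvature_left (hφ : φ ∈ Ioo 0 (π / 2)) (k₂ : ℝ) :
    Tendsto (fun k => arcCurvature φ k k₂) atTop (𝓝 (2 * φ)) := by
  obtain ⟨hs, hc⟩ := sin_cos_pos_of_mem hφ
  have hg : Tendsto (fun k => (k₂ + k * cos φ) / k) atTop (𝓝 (cos φ)) := by
    have := (tendsto_inv_atTop_zero (𝕜 := ℝ)).const_mul k₂ |>.add_const (cos φ)
    rw [mul_zero, zero_add] at this
    refine this.congr' ?_
    filter_upwards [eventually_gt_atTop 0] with k hk
    field_simp
  have h := (continuous_arctan.tendsto _).comp (tendsto_sqrt_one_add_sq_div (φ := φ) hc.ne' hg)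
  rw [← tan_eq_sin_div_cos, arctan_tan (by linarith [hφ.1, pi_pos]) hφ.2] at h
  simpa [arcCurvature, halfAngle] using (h.const_mul 2).mul tendsto_div_sqrt_one_add_sq

/-- By symmetry each side takes half: the half angle tends to `φ / 2`, because `sin φ / (1 + cos φ)
= tan (φ / 2)`. -/
lemma tendsto_arcCurvature_diag (hφ : φ ∈ Ioo 0 (π / 2)) :
    Tendsto (fun k => arcCurvature φ k k + arcCurvature φ k k) atTop (𝓝 (2 * φ)) := by
  obtain ⟨hs, hc⟩ := sin_cos_pos_of_mem hφ
  have hg : Tendsto (fun k => (k + k * cos φ) / k) atTop (𝓝 (1 + cos φ)) := by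
    refine tendsto_const_nhds.congr' ?_
    filter_upwards [eventually_gt_atTop 0] with k hk
    field_simp
  have h := (continuous_arctan.tendsto _).comp
    (tendsto_sqrt_one_add_sq_div (φ := φ) (by positivity) hg)
  have ht : sin φ / (1 + cos φ) = tan (φ / 2) := by
    have h2 : φ = 2 * (φ / 2) := by ring
    have hc2 : 0 < cos (φ / 2) :=
      cos_pos_of_mem_Ioo ⟨by linarith [hφ.1, pi_pos], by linarith [hφ.1, hφ.2]⟩
    rw [h2, sin_two_mul, cos_two_mul, ← h2, tan_eq_sin_div_cos]
    field_simp
    ring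
  rw [ht, arctan_tan (by linarith [hφ.1, pi_pos]) (by linarith [hφ.1, hφ.2])] at h
  have h' := (h.const_mul 2).mul tendsto_div_sqrt_one_add_sq
  have h'' := h'.add h'
  rwa [show 2 * (φ / 2) * 1 + 2 * (φ / 2) * 1 = 2 * φ by ring] at h''

lemma arcCurvature_add_lt (hφ : φ ∈ Ioo 0 (π / 2)) (h₁ : 0 < k₁) (h₂ : 0 < k₂) :
    arcCurvature φ k₁ k₂ + arcCurvature φ k₂ k₁ < 2 * φ := by
  -- The sum increases to its limit `2φ` along the diagonal; the `+ 1` makes the first comparison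
  -- strict.
  have hm : 0 < max k₁ k₂ + 1 := by positivity
  refine (arcCurvature_add_strictMono hφ h₁ h₂ (k₁' := max k₁ k₂ + 1) (k₂' := max k₁ k₂ + 1)
    (by linarith [le_max_left k₁ k₂]) (by linarith [le_max_right k₁ k₂])).trans_le ?_
  refine ge_of_tendsto (tendsto_arcCurvature_diag hφ) ?_
  filter_upwards [eventually_ge_atTop (max k₁ k₂ + 1)] with m h
  exact arcCurvature_add_mono hφ hm hm h h

end

/-! ### The central angle of a side of a bigon -/

lemma volume_cos_gt {θ : ℝ} (h₀ : 0 ≤ θ) (hπ : θ < π) :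
    MeasureTheory.volume {τ : ℝ | τ ∈ Ioc (-π) π ∧ cos θ < cos τ} = ENNReal.ofReal (2 * θ) := by
  have : {τ : ℝ | τ ∈ Ioc (-π) π ∧ cos θ < cos τ} = Ioo (-θ) θ := by
    ext τ
    simp only [mem_ofPred_eq, mem_Ioc, mem_Ioo]
    rw [← abs_lt, ← cos_abs τ]
    constructor
    · rintro ⟨⟨h1, h2⟩, h⟩
      by_contra hn
      push Not at hn
      exact h.not_ge (cos_le_cos_of_nonneg_of_le_pi h₀ (abs_le.2 ⟨h1.le, h2⟩) hn)
    · intro h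
      have := abs_lt.1 h
      exact ⟨⟨by linarith, by linarith⟩, cos_lt_cos_of_nonneg_of_le_pi (abs_nonneg _) hπ.le h⟩
  rw [this, Real.volume_Ioo]
  congr 1
  ring

lemma norm_circlePoint (r τ : ℝ) : ‖circlePoint r τ‖ = 1 := by
  rw [EuclideanSpace.norm_eq, sqrt_eq_one]
  simp only [circlePoint, Fin.sum_univ_three, Real.norm_eq_abs, sq_abs]
  simp
  linear_combination sin r ^ 2 * sin_sq_add_cos_sq τ + sin_sq_add_cos_sq r

lemma inner_circlePoint_zero (d r τ : ℝ) :
    inner ℝ (circlePoint d 0) (circlePoint r τ) = sin d * sin r * cos τ + cos d * cos r := by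
  simp [circlePoint, PiLp.inner_apply, Fin.sum_univ_three]
  ring

lemma circlePoint_mem_sphericalDisk_iff {d r₁ r₂ τ : ℝ} (h₂ : r₂ ∈ Icc 0 π) :
    circlePoint r₁ τ ∈ sphericalDisk (circlePoint d 0) r₂ ↔
      cos r₂ < sin d * sin r₁ * cos τ + cos d * cos r₁ := by
  rw [sphericalDisk, mem_ofPred_eq, ← inner_circlePoint_zero]
  simp only [norm_circlePoint, true_and, InnerProductGeometry.angle, mul_one, div_one]
  have hle : |inner ℝ (circlePoint d 0) (circlePoint r₁ τ)| ≤ 1 := by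
    simpa [norm_circlePoint] using abs_real_inner_le_norm (circlePoint d 0) (circlePoint r₁ τ)
  rw [abs_le] at hle
  conv_rhs => rw [← cos_arccos hle.1 hle.2]
  exact (strictAntiOn_cos.lt_iff_gt h₂ ⟨arccos_nonneg _, arccos_le_pi _⟩).symm

lemma sin_eq_inv_sqrt_cot {r : ℝ} (hr : r ∈ Ioo 0 (π / 2)) : sin r = 1 / √(1 + cot r ^ 2) := by
  obtain ⟨hs, hc⟩ := sin_cos_pos_of_mem hr
  have : 1 + cot r ^ 2 = (1 / sin r) ^ 2 := by
    rw [cot_eq_cos_div_sin]; field_simp; exact sin_sq_add_cos_sq r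
  rw [this, sqrt_sq (by positivity), one_div_one_div]

lemma cos_eq_cot_div_sqrt {r : ℝ} (hr : r ∈ Ioo 0 (π / 2)) : cos r = cot r / √(1 + cot r ^ 2) := by
  obtain ⟨hs, hc⟩ := sin_cos_pos_of_mem hr
  rw [div_eq_mul_one_div, ← sin_eq_inv_sqrt_cot hr, cot_eq_cos_div_sin]
  field_simp

lemma cot_pos_of_mem {r : ℝ} (hr : r ∈ Ioo 0 (π / 2)) : 0 < cot r := by
  obtain ⟨hs, hc⟩ := sin_cos_pos_of_mem hr
  rw [cot_eq_cos_div_sin]; positivity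

/-- The spherical law of cosines, for the distance of the centers and the half angle at the first
center. -/
lemma cos_centerDist_halfAngle {r₁ r₂ φ : ℝ} (h₁ : r₁ ∈ Ioo 0 (π / 2)) (h₂ : r₂ ∈ Ioo 0 (π / 2))
    (hφ : φ ∈ Ioo 0 (π / 2)) :
    0 < sin (centerDist r₁ r₂ φ) ∧
    sin (centerDist r₁ r₂ φ) * sin r₁ * cos (halfAngle φ (cot r₁) (cot r₂)) +
      cos (centerDist r₁ r₂ φ) * cos r₁ = cos r₂ := by
  obtain ⟨hs, hc⟩ := sin_cos_pos_of_mem hφ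
  have hk₁ := cot_pos_of_mem h₁
  have hk₂ := cot_pos_of_mem h₂
  set k₁ := cot r₁ with hk₁d
  set k₂ := cot r₂ with hk₂d
  have hw := sqrt_one_add_sq_pos k₁
  have hv := sqrt_one_add_sq_pos k₂
  have hw2 := sq_sqrt (show 0 ≤ 1 + k₁ ^ 2 by positivity)
  have hv2 := sq_sqrt (show 0 ≤ 1 + k₂ ^ 2 by positivity)
  have hD : 0 < k₁ ^ 2 + k₂ ^ 2 + 2 * k₁ * k₂ * cos φ + sin φ ^ 2 := by positivity
  have hb : 0 < k₂ + k₁ * cos φ := by positivity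
  have hD1 := sq_add_sq_mul_sin_sq φ k₁ k₂
  have hD2 := sq_sqrt hD.le
  have hDp := sqrt_pos.2 hD
  set D := k₁ ^ 2 + k₂ ^ 2 + 2 * k₁ * k₂ * cos φ + sin φ ^ 2 with hDdef
  have hcosθ : cos (halfAngle φ k₁ k₂) = (k₂ + k₁ * cos φ) / √D := by
    rw [halfAngle, cos_arctan, ← hD1]
    have : (k₂ + k₁ * cos φ) ^ 2 + (√(1 + k₁ ^ 2) * sin φ) ^ 2 = (k₂ + k₁ * cos φ) ^ 2 *
        (1 + (√(1 + k₁ ^ 2) * sin φ / (k₂ + k₁ * cos φ)) ^ 2) := by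
      field_simp
    rw [this, sqrt_mul (by positivity), sqrt_sq hb.le]
    field_simp
  have hx : cos r₁ * cos r₂ + sin r₁ * sin r₂ * cos (π - φ) =
      (k₁ * k₂ - cos φ) / (√(1 + k₁ ^ 2) * √(1 + k₂ ^ 2)) := by
    rw [sin_eq_inv_sqrt_cot h₁, sin_eq_inv_sqrt_cot h₂, cos_eq_cot_div_sqrt h₁,
      cos_eq_cot_div_sqrt h₂, cos_pi_sub, ← hk₁d, ← hk₂d]
    field_simp
    ring
  -- This gives `sin` of the distance, and also shows that the argument of `arccos` lies in `[-1,
  -- 1]`, so `arccos` is not truncated.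
  have hx2 : 1 - ((k₁ * k₂ - cos φ) / (√(1 + k₁ ^ 2) * √(1 + k₂ ^ 2))) ^ 2 =
      (√D / (√(1 + k₁ ^ 2) * √(1 + k₂ ^ 2))) ^ 2 := by
    rw [div_pow, div_pow, mul_pow, hw2, hv2, hD2, hDdef]
    field_simp
    linear_combination -sin_sq_add_cos_sq φ
  have hsin : sin (centerDist r₁ r₂ φ) = √D / (√(1 + k₁ ^ 2) * √(1 + k₂ ^ 2)) := by
    rw [centerDist, sin_arccos, hx, hx2, sqrt_sq (by positivity)]
  have hcos : cos (centerDist r₁ r₂ φ) =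
      (k₁ * k₂ - cos φ) / (√(1 + k₁ ^ 2) * √(1 + k₂ ^ 2)) := by
    have : ((k₁ * k₂ - cos φ) / (√(1 + k₁ ^ 2) * √(1 + k₂ ^ 2))) ^ 2 ≤ 1 := by
      have := sq_nonneg (√D / (√(1 + k₁ ^ 2) * √(1 + k₂ ^ 2)))
      linarith
    rw [sq_le_one_iff_abs_le_one, abs_le] at this
    rw [centerDist, hx, cos_arccos this.1 this.2]
  refine ⟨by rw [hsin]; positivity, ?_⟩
  rw [hsin, hcos, hcosθ, sin_eq_inv_sqrt_cot h₁, cos_eq_cot_div_sqrt h₁, cos_eq_cot_div_sqrt h₂,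
    ← hk₁d, ← hk₂d]
  field_simp
  linear_combination -k₂ * hw2

lemma centralAngle_eq {r₁ r₂ φ : ℝ} (h₁ : r₁ ∈ Ioo 0 (π / 2)) (h₂ : r₂ ∈ Ioo 0 (π / 2))
    (hφ : φ ∈ Ioo 0 (π / 2)) :
    centralAngle r₁ r₂ φ = 2 * halfAngle φ (cot r₁) (cot r₂) := by
  obtain ⟨hd, hcd⟩ := cos_centerDist_halfAngle h₁ h₂ hφ
  have hθ := halfAngle_pos hφ (cot_pos_of_mem h₁) (cot_pos_of_mem h₂)
  have hθ' : halfAngle φ (cot r₁) (cot r₂) < π := by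
    have := arctan_lt_pi_div_two (√(1 + cot r₁ ^ 2) * sin φ / (cot r₂ + cot r₁ * cos φ))
    unfold halfAngle
    linarith [pi_pos]
  have hs := (sin_cos_pos_of_mem h₁).1
  have hiff : ∀ τ, circlePoint r₁ τ ∈ secondDisk r₁ r₂ φ ↔
      cos (halfAngle φ (cot r₁) (cot r₂)) < cos τ := by
    intro τ
    rw [secondDisk, circlePoint_mem_sphericalDisk_iff ⟨h₂.1.le, by linarith [h₂.2, pi_pos]⟩,
      ← hcd, add_lt_add_iff_right, mul_lt_mul_iff_right₀ (by positivity)]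
  simp only [centralAngle, hiff]
  rw [volume_cos_gt hθ.le hθ', ENNReal.toReal_ofReal (by positivity)]

lemma bigonSideLength_mul_cot {r₁ r₂ φ : ℝ} (h₁ : r₁ ∈ Ioo 0 (π / 2)) (h₂ : r₂ ∈ Ioo 0 (π / 2))
    (hφ : φ ∈ Ioo 0 (π / 2)) :
    bigonSideLength r₁ r₂ φ * cot r₁ = arcCurvature φ (cot r₁) (cot r₂) := by
  rw [bigonSideLength, centralAngle_eq h₁ h₂ hφ, arcCurvature, sin_eq_inv_sqrt_cot h₁]
  ring

/-! ### Isotopies -/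

section
variable {X Y Z : Type*} [TopologicalSpace X] [TopologicalSpace Y] [TopologicalSpace Z]

lemma Isotopic.refl (g : X ≃ₜ Y) : Isotopic g g :=
  ⟨fun _ => g, g.continuous.comp continuous_snd, rfl, rfl⟩

lemma Isotopic.symm {g h : X ≃ₜ Y} : Isotopic g h → Isotopic h g := by
  rintro ⟨H, hH, h0, h1⟩
  refine ⟨fun t => H (unitInterval.symm t), ?_, by simpa using h1, by simpa using h0⟩
  exact hH.comp ((unitInterval.continuous_symm.comp continuous_fst).prodMk continuous_snd)

lemma Isotopic.trans {g h k : X ≃ₜ Y} : Isotopic g h → Isotopic h k → Isotopic g k := by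
  rintro ⟨H, hH, h0, h1⟩ ⟨K, hK, k0, k1⟩
  -- Each isotopy is run at double speed on its half; `projIcc` clamps the time outside that half.
  let a : unitInterval → unitInterval := fun t => projIcc 0 1 zero_le_one (2 * (t : ℝ))
  let b : unitInterval → unitInterval := fun t => projIcc 0 1 zero_le_one (2 * (t : ℝ) - 1)
  have ha : Continuous a := continuous_projIcc.comp (by fun_prop)
  have hb : Continuous b := continuous_projIcc.comp (by fun_prop)
  classical
  refine ⟨fun t => if (t : ℝ) ≤ 1 / 2 then H (a t) else K (b t), ?_, ?_, ?_⟩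
  · have : (fun p : unitInterval × X =>
        (if (p.1 : ℝ) ≤ 1 / 2 then H (a p.1) else K (b p.1)) p.2) =
        fun p => if (p.1 : ℝ) ≤ 1 / 2 then H (a p.1) p.2 else K (b p.1) p.2 := by
      funext p
      split_ifs <;> rfl
    rw [this]
    refine Continuous.if_le (hH.comp ((ha.comp continuous_fst).prodMk continuous_snd))
      (hK.comp ((hb.comp continuous_fst).prodMk continuous_snd)) (by fun_prop) (by fun_prop) ?_
    intro p hp
    have e1 : a p.1 = 1 := projIcc_of_right_le _ (by rw [hp]; norm_num)
    have e2 : b p.1 = 0 := projIcc_of_le_left _ (by rw [hp]; norm_num)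
    simp only [e1, e2, h1, k0]
  · have e1 : a 0 = 0 := projIcc_of_le_left _ (by simp)
    simp [e1, h0]
  · have e2 : b 1 = 1 := projIcc_of_right_le _ (by norm_num)
    have : ¬ ((1 : ℝ) ≤ 1 / 2) := by norm_num
    simp only [Icc.coe_one, this, if_false, e2, k1]

lemma Isotopic.comp_left {g h : Y ≃ₜ Z} (k : X ≃ₜ Y) :
    Isotopic g h → Isotopic (k.trans g) (k.trans h) := by
  rintro ⟨H, hH, h0, h1⟩
  exact ⟨fun t => k.trans (H t),
    hH.comp (continuous_fst.prodMk (k.continuous.comp continuous_snd)), by simp only [h0], by simp only [h1]⟩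

end

/-- A circle pattern metric is determined, up to isometry, by the radii. -/
lemma CirclePatternMetric.isIsometric_of_radius_eq {S E F : Type*} [TopologicalSpace S]
    {C : CellularDecomposition S E F} {Φ : E → ℝ} {μ₁ μ₂ : CirclePatternMetric C Φ}
    (h : μ₁.radius = μ₂.radius) : μ₁.IsIsometric μ₂ := by
  refine ⟨μ₁.marking.symm.trans μ₂.marking, ?_, fun x y => ?_, fun s => by simp, congrFun h⟩
  · have := (μ₂.isotopic.trans μ₁.isotopic.symm).comp_left μ₁.marking.symm
    rwa [Homeomorph.symm_trans_self] at this
  · obtain ⟨p, rfl⟩ := μ₁.marking.surjective x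
    obtain ⟨q, rfl⟩ := μ₁.marking.surjective y
    simp [μ₁.dist_eq, μ₂.dist_eq, h]

/-- The circle pattern metric with given radii, on the cellular decomposition itself. -/
noncomputable def CirclePatternMetric.ofRadius {S E F : Type*} [TopologicalSpace S]
    (C : CellularDecomposition S E F) (Φ : E → ℝ) (r : F → ℝ) (hr : ∀ f, r f ∈ Ioo 0 (π / 2)) :
    CirclePatternMetric C Φ where
  dist x y := C.toCellData.gluedDist Φ r (C.homeo.symm x) (C.homeo.symm y)
  radius := r
  radius_mem := hr
  marking := C.homeo
  isotopic := Isotopic.refl _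
  dist_eq p q := by simp

/-! ### The total geodesic curvatures as functions of the geodesic curvatures -/

namespace CellData

variable {E F : Type*} (C : CellData E F) {Φ : E → ℝ}

/-- The part of the curvature of the sides of the 1-cell `e` which belongs to 2-cells in `F'`. -/
noncomputable def edgeCurvature (Φ : E → ℝ) (k : F → ℝ) (F' : Finset F) (e : E) : ℝ :=
  open Classical in
  (if C.face (e, false) ∈ F' then
    arcCurvature (Φ e) (k (C.face (e, false))) (k (C.face (e, true))) else 0) +
  if C.face (e, true) ∈ F' then
    arcCurvature (Φ e) (k (C.face (e, true))) (k (C.face (e, false))) else 0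

/-- Dropping a side outside `F'` drops a positive term from a sum that is below `2 Φ(e)`. -/
lemma edgeCurvature_lt (hΦ : ∀ e, Φ e ∈ Ioo 0 (π / 2)) {k : F → ℝ} (hk : ∀ f, 0 < k f)
    (F' : Finset F) (e : E) : C.edgeCurvature Φ k F' e < 2 * Φ e := by
  have h := arcCurvature_add_lt (hΦ e) (hk (C.face (e, false))) (hk (C.face (e, true)))
  have h1 := arcCurvature_pos (hΦ e) (hk (C.face (e, false))) (hk (C.face (e, true)))
  have h2 := arcCurvature_pos (hΦ e) (hk (C.face (e, true))) (hk (C.face (e, false)))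
  unfold edgeCurvature
  split_ifs <;> linarith [(hΦ e).1]

lemma edgeCurvature_univ [Fintype F] (k : F → ℝ) (e : E) :
    C.edgeCurvature Φ k Finset.univ e =
      arcCurvature (Φ e) (k (C.face (e, false))) (k (C.face (e, true))) +
      arcCurvature (Φ e) (k (C.face (e, true))) (k (C.face (e, false))) := by
  simp [edgeCurvature]

variable [Fintype E]

/-- The total geodesic curvature of the 2-cell `f`, in terms of the geodesic curvatures `k` of the
circles. -/
noncomputable def faceCurvature (Φ : E → ℝ) (k : F → ℝ) (f : F) : ℝ :=
  open Classical in
  ∑ s : E × Bool with C.face s = f,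
    arcCurvature (Φ s.1) (k (C.face s)) (k (C.face (opposite s)))

lemma totalGeodesicCurvature_eq (hΦ : ∀ e, Φ e ∈ Ioo 0 (π / 2)) {r : F → ℝ}
    (hr : ∀ f, r f ∈ Ioo 0 (π / 2)) (f : F) :
    C.totalGeodesicCurvature Φ r f = C.faceCurvature Φ (fun g => cot (r g)) f :=
  Finset.sum_congr rfl fun _ _ => bigonSideLength_mul_cot (hr _) (hr _) (hΦ _)

/-- Double counting: the sides are regrouped by 1-cell instead of by face, so that the symmetric
sums of the bigons appear. -/
lemma sum_faceCurvature (k : F → ℝ) (F' : Finset F) :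
    ∑ f ∈ F', C.faceCurvature Φ k f = ∑ e ∈ C.edgesOf F', C.edgeCurvature Φ k F' e := by
  classical
  have h1 : ∑ f ∈ F', C.faceCurvature Φ k f = ∑ e, C.edgeCurvature Φ k F' e := by
    simp only [faceCurvature, Finset.sum_filter]
    rw [Finset.sum_comm, Fintype.sum_prod_type]
    refine Finset.sum_congr rfl fun e _ => ?_
    simp only [Fintype.sum_bool, opposite, edgeCurvature, Finset.sum_ite_eq, Bool.not_true,
      Bool.not_false]
    rw [add_comm]
  rw [h1]
  refine (Finset.sum_subset (Finset.subset_univ _) fun e _ he => ?_).symm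
  simp only [edgesOf, Finset.mem_filter, Finset.mem_univ, true_and, Bool.exists_bool,
    not_or] at he
  simp [edgeCurvature, he]

lemma edgesOf_nonempty {F' : Finset F} (h : F'.Nonempty) : (C.edgesOf F').Nonempty := by
  obtain ⟨f, hf⟩ := h
  obtain ⟨⟨e, b⟩, rfl⟩ := C.face_surjective f
  exact ⟨e, by simp only [edgesOf, Finset.mem_filter, Finset.mem_univ, true_and]; exact ⟨b, hf⟩⟩

lemma faceCurvature_mem_admissible (hΦ : ∀ e, Φ e ∈ Ioo 0 (π / 2)) {k : F → ℝ}
    (hk : ∀ f, 0 < k f) : C.faceCurvature Φ k ∈ C.admissible Φ := by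
  classical
  refine ⟨fun f => Finset.sum_pos (fun s _ => arcCurvature_pos (hΦ _) (hk _) (hk _)) ?_,
    fun F' hF' => ?_⟩
  · obtain ⟨s, hs⟩ := C.face_surjective f
    exact ⟨s, by simpa using hs⟩
  · rw [sum_faceCurvature, Finset.mul_sum]
    exact Finset.sum_lt_sum_of_nonempty (C.edgesOf_nonempty hF')
      fun e _ => C.edgeCurvature_lt hΦ hk F' e

/-- The curvature of a 2-cell decreases if the curvatures of other 2-cells increase. -/
lemma faceCurvature_anti (hΦ : ∀ e, Φ e ∈ Ioo 0 (π / 2)) {k k' : F → ℝ} (hk : ∀ f, 0 < k f)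
    (h : ∀ f, k f ≤ k' f) {f : F} (hf : k' f = k f) :
    C.faceCurvature Φ k' f ≤ C.faceCurvature Φ k f := by
  classical
  refine Finset.sum_le_sum fun s hs => ?_
  have hs : C.face s = f := by simpa using hs
  rw [hs, hf]
  exact arcCurvature_anti (hΦ _) (hk _) (hk _) (h _)

lemma sum_faceCurvature_lt [Fintype F] (hΦ : ∀ e, Φ e ∈ Ioo 0 (π / 2)) {k k' : F → ℝ}
    (hk : ∀ f, 0 < k f) (h : ∀ f, k f ≤ k' f) {f : F} (hf : k f < k' f) :
    ∑ f, C.faceCurvature Φ k f < ∑ f, C.faceCurvature Φ k' f := by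
  rw [sum_faceCurvature, sum_faceCurvature]
  simp only [edgeCurvature_univ]
  obtain ⟨⟨e, b⟩, rfl⟩ := C.face_surjective f
  refine Finset.sum_lt_sum (fun e _ => arcCurvature_add_mono (hΦ e) (hk _) (hk _) (h _) (h _))
    ⟨e, ?_, ?_⟩
  · simp [edgesOf]
  · cases b
    · exact arcCurvature_add_strictMono (hΦ e) (hk _) (hk _) hf (h _)
    · rw [add_comm, add_comm (arcCurvature _ (k' _) _)]
      exact arcCurvature_add_strictMono (hΦ e) (hk _) (hk _) hf (h _)

/-! ### Uniqueness: the maximum principle -/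

lemma finite_faces {E F : Type*} [Finite E] (C : CellData E F) : Finite F := Finite.of_surjective _ C.face_surjective

lemma le_of_faceCurvature_eq (hΦ : ∀ e, Φ e ∈ Ioo 0 (π / 2)) {k k' : F → ℝ}
    (hk : ∀ f, 0 < k f) (hk' : ∀ f, 0 < k' f)
    (h : C.faceCurvature Φ k = C.faceCurvature Φ k') (f : F) : k f ≤ k' f := by
  have := C.finite_faces
  have := Fintype.ofFinite F
  by_contra! hf
  have hlt := C.sum_faceCurvature_lt hΦ hk' (k' := fun g => max (k g) (k' g))
    (fun g => le_max_right _ _) (f := f) (lt_max_of_lt_left hf)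
  -- At each face the maximum equals `k` or `k'`; compared with that one, only other faces have been
  -- raised.
  refine hlt.not_ge (Finset.sum_le_sum fun g _ => ?_)
  rcases le_total (k g) (k' g) with hg | hg
  · exact C.faceCurvature_anti hΦ hk' (fun _ => le_max_right _ _) (max_eq_right hg)
  · exact (C.faceCurvature_anti hΦ hk (fun _ => le_max_left _ _) (max_eq_left hg)).trans_eq
      (congrFun h g)

lemma faceCurvature_injOn (hΦ : ∀ e, Φ e ∈ Ioo 0 (π / 2)) :
    InjOn (C.faceCurvature Φ) {k | ∀ f, 0 < k f} := fun _ hk _ hk' h =>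
  funext fun f => (C.le_of_faceCurvature_eq hΦ hk hk' h f).antisymm
    (C.le_of_faceCurvature_eq hΦ hk' hk h.symm f)

lemma continuousOn_faceCurvature (hΦ : ∀ e, Φ e ∈ Ioo 0 (π / 2)) (f : F) :
    ContinuousOn (fun k => C.faceCurvature Φ k f) {k | ∀ f, 0 < k f} := by
  unfold faceCurvature
  refine continuousOn_finsetSum _ fun s _ => ?_
  exact (continuousOn_arcCurvature (hΦ s.1)).comp
    (f := fun k : F → ℝ => (k (C.face s), k (C.face (opposite s))))
    (by fun_prop) fun k hk => ⟨hk _, hk _⟩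

lemma faceCurvature_le {k : F → ℝ} (f : F) (hk : 0 < k f) :
    C.faceCurvature Φ k f ≤ Fintype.card (E × Bool) * (π * k f) := by
  classical
  have h : C.faceCurvature Φ k f ≤ ∑ s : E × Bool with C.face s = f, π * k f := by
    refine Finset.sum_le_sum fun s hs => ?_
    have hs : C.face s = f := by simpa using hs
    rw [hs]
    exact arcCurvature_le hk
  refine h.trans ?_
  rw [Finset.sum_const, nsmul_eq_mul]
  have := pi_pos
  gcongr
  exact Finset.card_le_univ _

/-! ### Existence: Perron's method -/

/-- The part of the curvature along a 1-cell that belongs to shrinking circles becomes arbitrarily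
close to twice the angle, if the other circles do not shrink. -/
lemma eventually_lt_edgeCurvature (hΦ : ∀ e, Φ e ∈ Ioo 0 (π / 2)) {ι : Type*} {l : Filter ι}
    {k : ι → F → ℝ} (hk : ∀ i f, 0 < k i f) {F' : Finset F}
    (hF' : ∀ f ∈ F', Tendsto (fun i => k i f) l atTop)
    (hbdd : ∀ f ∉ F', ∃ M, ∀ᶠ i in l, k i f ≤ M) {e : E} (he : e ∈ C.edgesOf F') {c : ℝ}
    (hc : c < 2 * Φ e) : ∀ᶠ i in l, c < C.edgeCurvature Φ (k i) F' e := by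
  have one_sided : ∀ f g : F, f ∈ F' → g ∉ F' →
      ∀ᶠ i in l, c < arcCurvature (Φ e) (k i f) (k i g) := by
    intro f g hf hg
    obtain ⟨M, hM⟩ := hbdd g hg
    filter_upwards [hM, (hF' f hf).eventually
      ((tendsto_arcCurvature_left (hΦ e) M).eventually_const_lt hc)] with i h1 h2
    exact h2.trans_le (arcCurvature_anti (hΦ e) (hk _ _) (hk _ _) h1)
  simp only [edgesOf, Finset.mem_filter, Finset.mem_univ, true_and, Bool.exists_bool] at he
  unfold edgeCurvature
  by_cases h1 : C.face (e, false) ∈ F' <;> by_cases h2 : C.face (e, true) ∈ F'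
  · simp only [h1, h2, if_true]
    -- The two circles may shrink at different rates; monotonicity reduces this to a fixed point `m`
    -- on the diagonal.
    obtain ⟨m, hm, hm0⟩ := (((tendsto_arcCurvature_diag (hΦ e)).eventually_const_lt hc).and
      (eventually_gt_atTop 0)).exists
    filter_upwards [(hF' _ h1).eventually_ge_atTop m, (hF' _ h2).eventually_ge_atTop m]
      with i hi1 hi2
    exact hm.trans_le (arcCurvature_add_mono (hΦ e) hm0 hm0 hi1 hi2)
  · simpa only [h1, h2, if_true, if_false, add_zero] using one_sided _ _ h1 h2
  · simpa only [h1, h2, if_true, if_false, zero_add] using one_sided _ _ h2 h1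
  · exact absurd he (not_or.2 ⟨h1, h2⟩)

/-- The curvatures of the circles are bounded, if their total curvatures are bounded by an
admissible vector. -/
lemma exists_bound_of_faceCurvature_le (hΦ : ∀ e, Φ e ∈ Ioo 0 (π / 2)) {L : F → ℝ}
    (hL : L ∈ C.admissible Φ) :
    ∃ M, ∀ k : F → ℝ, (∀ f, 0 < k f) → (∀ f, C.faceCurvature Φ k f ≤ L f) → ∀ f, k f ≤ M := by
  classical
  have := C.finite_faces
  have := Fintype.ofFinite F
  by_contra! H
  choose k hk hkL f hf using fun n : ℕ => H n
  -- Along an ultrafilter every face either tends to infinity or is eventually bounded, so no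
  -- subsequences are needed.
  let F' : Finset F :=
    Finset.univ.filter fun f => Tendsto (fun i => k i f) (hyperfilter ℕ) atTop
  have hF' : ∀ f ∈ F', Tendsto (fun i => k i f) (hyperfilter ℕ) atTop := by simp [F']
  have hbdd : ∀ f ∉ F', ∃ M, ∀ᶠ i in (hyperfilter ℕ : Filter ℕ), k i f ≤ M := by
    intro f hf
    simp only [F', Finset.mem_filter, Finset.mem_univ, true_and, tendsto_atTop, not_forall] at hf
    obtain ⟨M, hM⟩ := hf
    refine ⟨M, ?_⟩
    filter_upwards [Ultrafilter.eventually_not.2 hM] with i hi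
    exact (not_le.1 hi).le
  -- Otherwise a common bound `B` holds for all faces, although `k i (f i) > i`.
  have hne : F'.Nonempty := by
    by_contra hemp
    rw [Finset.not_nonempty_iff_eq_empty] at hemp
    choose M hM using fun f => hbdd f (by simp [hemp])
    obtain ⟨B, hB⟩ := Set.finite_range M |>.bddAbove
    have hnat : ∀ᶠ i : ℕ in (hyperfilter ℕ : Filter ℕ), B ≤ i :=
      (tendsto_natCast_atTop_atTop.eventually_ge_atTop B).filter_mono Nat.hyperfilter_le_atTop
    obtain ⟨i, hi1, hi2⟩ := ((eventually_all.2 hM).and hnat).exists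
    have h1 := hi1 (f i)
    have h2 := hB (mem_range_self (f i))
    linarith [hf i]
  have hE := C.edgesOf_nonempty hne
  have hcard : (0 : ℝ) < (C.edgesOf F').card := by exact_mod_cast hE.card_pos
  have hlt := hL.2 F' hne
  -- The gap in the admissibility inequality, shared equally among the 1-cells: the lower bounds `2
  -- Φ(e) - δ` add up to exactly `∑ L`.
  set δ := (2 * ∑ e ∈ C.edgesOf F', Φ e - ∑ f ∈ F', L f) / (C.edgesOf F').card with hδ
  have hδ0 : 0 < δ := div_pos (by linarith) hcard
  have hev : ∀ᶠ i in (hyperfilter ℕ : Filter ℕ), ∀ e ∈ C.edgesOf F',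
      2 * Φ e - δ < C.edgeCurvature Φ (k i) F' e :=
    (Finset.eventually_all _).2 fun e he =>
      C.eventually_lt_edgeCurvature hΦ hk hF' hbdd he (by linarith)
  obtain ⟨i, hi⟩ := hev.exists
  have h1 := Finset.sum_lt_sum_of_nonempty hE hi
  rw [← sum_faceCurvature, Finset.sum_sub_distrib, Finset.sum_const, nsmul_eq_mul, hδ,
    mul_div_cancel₀ _ hcard.ne', ← Finset.mul_sum] at h1
  have h2 := Finset.sum_le_sum fun f (_ : f ∈ F') => hkL i f
  linarith

lemma exists_faceCurvature_eq (hΦ : ∀ e, Φ e ∈ Ioo 0 (π / 2)) {L : F → ℝ}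
    (hL : L ∈ C.admissible Φ) : ∃ k : F → ℝ, (∀ f, 0 < k f) ∧ C.faceCurvature Φ k = L := by
  classical
  have := C.finite_faces
  have := Fintype.ofFinite F
  obtain ⟨M, hM⟩ := C.exists_bound_of_faceCurvature_le hΦ hL
  -- The constant `κ` is a subsolution. As a lower barrier it keeps the set of competitors compact
  -- inside the positive vectors.
  obtain ⟨κ, hκL, hκ⟩ : ∃ κ : ℝ, (∀ f, Fintype.card (E × Bool) * (π * κ) < L f) ∧ 0 < κ := by
    have h : ∀ f, ∀ᶠ κ in 𝓝[>] (0 : ℝ), Fintype.card (E × Bool) * (π * κ) < L f := by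
      intro f
      have hc : Tendsto (fun κ : ℝ => Fintype.card (E × Bool) * (π * κ)) (𝓝[>] 0) (𝓝 0) := by
        have : Continuous fun κ : ℝ => Fintype.card (E × Bool) * (π * κ) := by fun_prop
        simpa using (this.tendsto 0).mono_left nhdsWithin_le_nhds
      exact hc.eventually_lt_const (hL.1 f)
    exact ((eventually_all.2 h).and self_mem_nhdsWithin).exists
  let K : Set (F → ℝ) := Icc (fun _ => κ) (fun _ => M) ∩ (C.faceCurvature Φ) ⁻¹' Iic L
  have hpos : ∀ k ∈ Icc (fun _ : F => κ) (fun _ => M), ∀ f, 0 < k f :=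
    fun k hk f => hκ.trans_le (hk.1 f)
  have hcont : ContinuousOn (C.faceCurvature Φ) {k | ∀ f, 0 < k f} :=
    continuousOn_pi.2 (C.continuousOn_faceCurvature hΦ)
  have hKc : IsCompact K := isCompact_Icc.of_isClosed_subset
    ((hcont.mono hpos).preimage_isClosed_of_isClosed isClosed_Icc isClosed_Iic) inter_subset_left
  have hKn : K.Nonempty := by
    have h : ∀ f, C.faceCurvature Φ (fun _ => κ) f ≤ L f :=
      fun f => (C.faceCurvature_le f hκ).trans (hκL f).le
    exact ⟨fun _ => κ, ⟨le_rfl, hM _ (fun _ => hκ) h⟩, h⟩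
  obtain ⟨k, ⟨hkI, hkL⟩, hmax⟩ := hKc.exists_isMaxOn hKn
    (f := fun k => ∑ f, k f) (by fun_prop)
  have hk := hpos k hkI
  refine ⟨k, hk, funext fun f => (hkL f).antisymm ?_⟩
  by_contra! hlt
  -- By continuity there is room to raise `k f` at a face whose curvature is still too small.
  have hev : ∀ᶠ t in 𝓝[>] (0 : ℝ),
      C.faceCurvature Φ (Function.update k f (k f + t)) f < L f := by
    have hopen : {k : F → ℝ | ∀ f, 0 < k f} ∈ 𝓝 k := by
      have := set_pi_mem_nhds (s := fun _ => Ioi (0 : ℝ)) (x := k) (Set.toFinite univ)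
        fun f _ => Ioi_mem_nhds (hk f)
      filter_upwards [this] with x hx f using hx f (mem_univ f)
    have h0 : Function.update k f (k f + 0) = k := by simp
    have h1 : Tendsto (fun t => Function.update k f (k f + t)) (𝓝 0) (𝓝 k) := by
      have : Continuous fun t : ℝ => Function.update k f (k f + t) := by fun_prop
      simpa only [h0] using this.tendsto 0
    have h2 := ((C.continuousOn_faceCurvature hΦ f).continuousAt hopen).tendsto.comp h1
    exact (h2.eventually_lt_const hlt).filter_mono nhdsWithin_le_nhds
  obtain ⟨t, ht, ht0 : 0 < t⟩ := (hev.and self_mem_nhdsWithin).exists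
  set k' := Function.update k f (k f + t) with hk'
  have hle : ∀ g, k g ≤ k' g := by
    intro g
    rcases eq_or_ne g f with rfl | hg
    · simp [hk', ht0.le]
    · simp [hk', hg]
  have hk'L : ∀ g, C.faceCurvature Φ k' g ≤ L g := by
    intro g
    rcases eq_or_ne g f with rfl | hg
    · exact ht.le
    · exact (C.faceCurvature_anti hΦ hk hle (by simp [hk', hg])).trans (hkL g)
  have hmem : k' ∈ K := ⟨⟨fun g => (hkI.1 g).trans (hle g),
    hM k' (fun g => (hk g).trans_le (hle g)) hk'L⟩, hk'L⟩
  refine (isMaxOn_iff.1 hmax k' hmem).not_gt ?_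
  exact Finset.sum_lt_sum (fun g _ => hle g) ⟨f, Finset.mem_univ f, by simp [hk', ht0]⟩

end CellData

/-- On this interval `arctan` of the reciprocal inverts `cot`, which carries curvatures back to
radii. -/
lemma cot_injOn : InjOn cot (Ioo 0 (π / 2)) := by
  intro x hx y hy h
  have key : ∀ z ∈ Ioo 0 (π / 2), arctan (cot z)⁻¹ = z := fun z hz => by
    rw [cot_eq_cos_div_sin, inv_div, ← tan_eq_sin_div_cos,
      arctan_tan (by linarith [hz.1, pi_pos]) hz.2]
  rw [← key x hx, ← key y hy, h]

lemma arctan_inv_mem {k : ℝ} (hk : 0 < k) : arctan k⁻¹ ∈ Ioo 0 (π / 2) :=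
  ⟨arctan_pos.2 (inv_pos.2 hk), arctan_lt_pi_div_two _⟩

lemma cot_arctan_inv (k : ℝ) : cot (arctan k⁻¹) = k := by
  rw [cot_eq_cos_div_sin, ← inv_div, ← tan_eq_sin_div_cos, tan_arctan, inv_inv]

end CirclePattern

theorem theorem1p4 {S E F : Type*} [TopologicalSpace S] [Fintype E]
    (C : CirclePattern.CellularDecomposition S E F)
    (Φ : E → ℝ) (hΦ : ∀ e, Φ e ∈ Set.Ioo 0 (Real.pi / 2)) (L : F → ℝ) :
    ((∃ μ : CirclePattern.CirclePatternMetric C Φ, μ.totalGeodesicCurvature = L) ↔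
      L ∈ C.toCellData.admissible Φ) ∧
    ∀ μ₁ μ₂ : CirclePattern.CirclePatternMetric C Φ,
      μ₁.totalGeodesicCurvature = L → μ₂.totalGeodesicCurvature = L → μ₁.IsIsometric μ₂ := by
  open CirclePattern in
  have hcurv (μ : CirclePatternMetric C Φ) : μ.totalGeodesicCurvature =
      C.toCellData.faceCurvature Φ fun f => Real.cot (μ.radius f) :=
    funext fun f => C.toCellData.totalGeodesicCurvature_eq hΦ μ.radius_mem f
  have hpos (μ : CirclePattern.CirclePatternMetric C Φ) (f : F) : 0 < Real.cot (μ.radius f) :=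
    CirclePattern.cot_pos_of_mem (μ.radius_mem f)
  refine ⟨⟨?_, fun hL => ?_⟩, fun μ₁ μ₂ h₁ h₂ => ?_⟩
  · rintro ⟨μ, rfl⟩
    rw [hcurv]
    exact C.toCellData.faceCurvature_mem_admissible hΦ (hpos μ)
  · obtain ⟨k, hk, rfl⟩ := C.toCellData.exists_faceCurvature_eq hΦ hL
    refine ⟨CirclePattern.CirclePatternMetric.ofRadius C Φ (fun f => Real.arctan (k f)⁻¹)
      fun f => CirclePattern.arctan_inv_mem (hk f), ?_⟩
    rw [hcurv]
    simp only [CirclePattern.CirclePatternMetric.ofRadius, CirclePattern.cot_arctan_inv]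
  · refine CirclePattern.CirclePatternMetric.isIsometric_of_radius_eq (funext fun f => ?_)
    have h := C.toCellData.faceCurvature_injOn hΦ (hpos μ₁) (hpos μ₂)
      (by rw [← hcurv, ← hcurv, h₁, h₂])
    exact CirclePattern.cot_injOn (μ₁.radius_mem f) (μ₂.radius_mem f) (congrFun h f)
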